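/- Let $d,k,n\in\mathbb{N}$ with $n\ge k\ge 2$, let $x_1,\dots,x_n\in\mathbb{R}^d$ be distinct points with weights $\omega_1,\dots,\omega_n>0$, and let $\kappa^-,\kappa^+\in\mathbb{R}^k$ satisfy $0<\kappa_i^-\le\kappa_i^+$ for all $i\le k$ and $\sum_{i=1}^k\kappa_i^-\le\sum_{j=1}^n\omega_j\le\sum_{i=1}^k\kappa_i^+$. The weight-balanced partition polytope is the set of all $y=(y_{ij})\in\mathbb{R}^{k\times n}$ with $y_{ij}\ge 0$ for all $i,j$, $\sum_{i=1}^k y_{ij}=1$ for all $j\le n$, and $\kappa_i^-\le\sum_{j=1}^n y_{ij}\omega_j\le\kappa_i^+$ for all $i\le k$. For sites $S=(s_1,\dots,s_k)$ in $\mathbb{R}^d$ put $\Theta(y,S)=\sum_{i=1}^k\sum_{j=1}^n y_{ij}\omega_j\,(s_i^Ts_i-2x_j^Ts_i)$. Weight-balanced $k$-means starts from arbitrary sites $S^{(1)}$ in $\mathbb{R}^d$. In iteration $l=1,2,\dots$ it (1) computes an arbitrary vertex $y^{(l)}$ of the weight-balanced partition polytope that minimizes $\Theta(\cdot,S^{(l)})$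 over this polytope, and (2) lets $S^{(l+1)}$ consist of the centers of gravity $$s_i^{(l+1)}=\frac{1}{\sum_{j=1}^n y^{(l)}_{ij}\omega_j}\sum_{j=1}^n y^{(l)}_{ij}\omega_j x_j\qquad(i\le k).$$ It stops after iteration $l\ge 2$ if the objective function value did not decrease, that is, unless $\Theta(y^{(l)},S^{(l)})<\Theta(y^{(l-1)},S^{(l-1)})$; otherwise it continues with iteration $l+1$. Then every run of weight-balanced $k$-means performs at most $(40e\,k^2 n)^{(d+1)k-1}$ iterations, where $e$ is the Euler number. -/

import Mathlib

namespace WeightBalancedKMeans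

/-- Assignment vectors: `y i j` is the fraction of the weight of point `j` that belongs to
cluster `i`. -/
abbrev Assignment (k n : ℕ) := Fin k → Fin n → ℝ

/-- Tuples of `k` sites in Euclidean `d`-space. Coinciding sites are allowed. -/
abbrev Sites (d k : ℕ) := Fin k → EuclideanSpace ℝ (Fin d)

/-- The size (total weight) of the `i`-th cluster. -/
def clusterSize {k n : ℕ} (ω : Fin n → ℝ) (y : Assignment k n) (i : Fin k) : ℝ :=
  ∑ j, y i j * ω j

/-- The weight-balanced partition polytope. -/
def partitionPolytope {k n : ℕ} (ω : Fin n → ℝ) (κlo κhi : Fin k → ℝ) :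
    Set (Assignment k n) :=
  {y | (∀ i, κlo i ≤ clusterSize ω y i ∧ clusterSize ω y i ≤ κhi i) ∧
    (∀ j, ∑ i, y i j = 1) ∧ ∀ i j, 0 ≤ y i j}

/-- The center of gravity of the `i`-th cluster. -/
noncomputable def centerOfGravity {d k n : ℕ} (x : Fin n → EuclideanSpace ℝ (Fin d))
    (ω : Fin n → ℝ) (y : Assignment k n) (i : Fin k) : EuclideanSpace ℝ (Fin d) :=
  (clusterSize ω y i)⁻¹ • ∑ j, (y i j * ω j) • x j

/-- The least-squares objective of an assignment `y` for sites `s`, up to the additive constant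
`∑ j, ω j * ‖x j‖ ^ 2`. -/
noncomputable def objective {d k n : ℕ} (x : Fin n → EuclideanSpace ℝ (Fin d))
    (ω : Fin n → ℝ) (s : Sites d k) (y : Assignment k n) : ℝ :=
  ∑ i, ∑ j, y i j * ω j * (inner ℝ (s i) (s i) - 2 * inner ℝ (x j) (s i))

/-- `y` is a possible result of the assignment step for the sites `s`: an optimal basic feasible
solution, that is, an optimal vertex, of the linear program that minimizes the objective over the
weight-balanced partition polytope. -/
def IsOptimalVertex {d k n : ℕ} (x : Fin n → EuclideanSpace ℝ (Fin d)) (ω : Fin n → ℝ)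
    (κlo κhi : Fin k → ℝ) (s : Sites d k) (y : Assignment k n) : Prop :=
  y ∈ Set.extremePoints ℝ (partitionPolytope ω κlo κhi) ∧
    IsMinOn (objective x ω s) (partitionPolytope ω κlo κhi) y

/-- `IsExecution x ω κlo κhi s₀ N s y`: weight-balanced `k`-means, started with the sites `s₀`,
can perform `N` iterations (and has possibly not stopped yet), where iteration number
`l = 0, …, N - 1` uses the sites `s l` and computes the assignment `y l`.
Values of `s` after `N` and of `y` from `N` on are irrelevant. -/
structure IsExecution {d k n : ℕ} (x : Fin n → EuclideanSpace ℝ (Fin d)) (ω : Fin n → ℝ)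
    (κlo κhi : Fin k → ℝ) (s₀ : Sites d k) (N : ℕ)
    (s : ℕ → Sites d k) (y : ℕ → Assignment k n) : Prop where
  /-- The first iteration uses the input sites. -/
  start : s 0 = s₀
  /-- Step 1: an optimal vertex of the linear program for the current sites. -/
  assign : ∀ l < N, IsOptimalVertex x ω κlo κhi (s l) (y l)
  /-- Step 2: every site moves to the center of gravity of its cluster. -/
  update : ∀ l < N, ∀ i, s (l + 1) i = centerOfGravity x ω (y l) i
  /-- Iteration `l + 1` is followed by a further one only if it decreased the objective function
  value. (The first iteration has no previous value to be compared with.) -/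
  decrease : ∀ l, l + 2 < N → objective x ω (s (l + 1)) (y (l + 1)) < objective x ω (s l) (y l)

end WeightBalancedKMeans

/-!
By linear programming duality, an assignment is optimal for sites `s` if and only if it satisfies
complementary slackness together with some multipliers `μ` of the cluster size constraints, and
this depends on `(s, μ)` only through the signs of the `μ i` and of all differences
`(‖s i‖² - 2⟪x j, s i⟫ + μ i) - (‖s i'‖² - 2⟪x j, s i'⟫ + μ i')`. These differences are `n k²`
linear forms on a space of dimension `(d + 1) k - 1` (one height in the lifted space can be
normalized to zero), and `p` linear forms on a space of dimension `r` have at most `(3 p + 1) ^ r`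
sign vectors.

If two iterations `l + 1 < m` had the same signs, the assignment of iteration `l` would be optimal
for the sites of iteration `m`. But the objective has decreased since iteration `l + 1`, whose
value is at most the least value that the assignment of iteration `l` attains for any sites. Hence
at most two consecutive iterations share their signs, apart from the last iteration, which need
not decrease the objective.
-/

section Farkas

open Filter Module

variable {𝕜 V ι : Type*} [Field 𝕜] [AddCommGroup V] [Module 𝕜 V]

theorem exists_eq_add_smul_of_eqOn_ker {f g c : Dual 𝕜 V}
    (h : ∀ v ∈ LinearMap.ker f, c v = g v) : ∃ r : 𝕜, c = g + r • f := by
  have hle : ⨅ _ : Unit, LinearMap.ker f ≤ LinearMap.ker (c - g) := fun v hv => by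
    simpa [sub_eq_zero] using h v (by simpa using hv)
  have hmem := mem_span_of_iInf_ker_le_ker hle
  rw [Set.range_const, Submodule.mem_span_singleton] at hmem
  obtain ⟨r, hr⟩ := hmem
  exact ⟨r, eq_add_of_sub_eq' hr.symm⟩

variable [LinearOrder 𝕜] [IsStrictOrderedRing 𝕜]

theorem exists_nonneg_sum_smul_eq_of_forall_nonneg [Fintype ι] (s : Finset ι) (a : ι → Dual 𝕜 V)
    (c : Dual 𝕜 V) (h : ∀ v, (∀ i ∈ s, 0 ≤ a i v) → 0 ≤ c v) :
    ∃ b : ι → 𝕜, (∀ i, 0 ≤ b i) ∧ (∀ i ∉ s, b i = 0) ∧ c = ∑ i, b i • a i := by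
  classical
  induction s using Finset.induction_on generalizing V with
  | empty =>
    refine ⟨0, fun _ => le_rfl, fun _ _ => rfl, LinearMap.ext fun v => ?_⟩
    have hneg := h (-v) (by simp)
    rw [map_neg, neg_nonneg] at hneg
    simpa using hneg.antisymm (h v (by simp))
  | insert i₀ s _ ih =>
    by_cases hs : ∀ v, (∀ i ∈ s, 0 ≤ a i v) → 0 ≤ c v
    · obtain ⟨b, hb, hbs, hbc⟩ := ih a c hs
      exact ⟨b, hb, fun i hi => hbs i (mt Finset.mem_insert_of_mem hi), hbc⟩
    push Not at hs
    obtain ⟨u, hu, hcu⟩ := hs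
    have hau : a i₀ u < 0 := by
      contrapose! hcu
      exact h u (Finset.forall_mem_insert .. |>.2 ⟨hcu, hu⟩)
    let K := LinearMap.ker (a i₀)
    obtain ⟨b, hb, hbs, hbc⟩ := ih (fun i => (a i).domRestrict K) (c.domRestrict K) fun v hv =>
      h v (Finset.forall_mem_insert .. |>.2 ⟨v.2.ge, hv⟩)
    obtain ⟨r, hr⟩ := exists_eq_add_smul_of_eqOn_ker (f := a i₀) (g := ∑ i, b i • a i) (c := c)
      fun v hv => by simpa using LinearMap.congr_fun hbc ⟨v, hv⟩
    have hrpos : 0 < r := by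
      have hsum : 0 ≤ ∑ i, b i * a i u := Finset.sum_nonneg fun i _ => by
        by_cases hi : i ∈ s
        · exact mul_nonneg (hb i) (hu i hi)
        · simp [hbs i hi]
      have hval : c u = ∑ i, b i * a i u + r * a i₀ u := by simp [hr]
      exact pos_of_mul_neg_left (by linarith) hau.le
    refine ⟨b + Pi.single i₀ r, fun i => ?_, fun i hi => ?_, ?_⟩
    · have hsingle : 0 ≤ (Pi.single i₀ r : ι → 𝕜) := Pi.single_nonneg.2 hrpos.le
      exact add_nonneg (hb i) (hsingle i)
    · rw [Finset.mem_insert, not_or] at hi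
      simp [hi.1, hbs i hi.2]
    · simp [hr, add_smul, Finset.sum_add_distrib, Pi.single_apply]

theorem exists_pos_forall_nonneg_add_mul [Finite ι] {t b : ι → 𝕜} (ht : ∀ i, 0 ≤ t i)
    (hb : ∀ i, t i = 0 → 0 ≤ b i) : ∃ ε > 0, ∀ i, 0 ≤ t i + ε * b i := by
  have hlarge : ∀ᶠ r in atTop, ∀ i, 0 ≤ r * t i + b i := by
    refine eventually_all.2 fun i => ?_
    rcases (ht i).eq_or_lt with hi | hi
    · simp [← hi, hb i hi.symm]
    · filter_upwards [(tendsto_id.atTop_mul_const hi).eventually_ge_atTop (-b i)] with r hr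
      exact neg_le_iff_add_nonneg.1 hr
  obtain ⟨r, hr, hr0⟩ := (hlarge.and (eventually_gt_atTop 0)).exists
  refine ⟨r⁻¹, inv_pos.2 hr0, fun i => ?_⟩
  have := mul_nonneg (inv_nonneg.2 hr0.le) (hr i)
  rwa [mul_add, inv_mul_cancel_left₀ hr0.ne'] at this

theorem exists_complementary_multipliers [Fintype ι] (a : ι → Dual 𝕜 V) (c : Dual 𝕜 V)
    {t : ι → 𝕜} (ht : ∀ i, 0 ≤ t i) (h : ∀ v, (∀ i, 0 ≤ t i + a i v) → 0 ≤ c v) :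
    ∃ b : ι → 𝕜, (∀ i, 0 ≤ b i) ∧ (∀ i, t i ≠ 0 → b i = 0) ∧ c = ∑ i, b i • a i := by
  classical
  obtain ⟨b, hb, hbt, hbc⟩ := exists_nonneg_sum_smul_eq_of_forall_nonneg
    (Finset.univ.filter fun i => t i = 0) a c fun v hv => by
      obtain ⟨ε, hε, hεv⟩ :=
        exists_pos_forall_nonneg_add_mul ht fun i hi => hv i (by simpa using hi)
      have hcv := h (ε • v) (by simpa using hεv)
      rw [map_smul, smul_eq_mul] at hcv
      exact nonneg_of_mul_nonneg_right hcv hε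
  exact ⟨b, hb, fun i hi => hbt i (by simpa using hi), hbc⟩

end Farkas

section SignVector

open Module

variable {𝕜 V ι κ : Type*} [Field 𝕜] [LinearOrder 𝕜] [AddCommGroup V] [Module 𝕜 V]

/-- The position of `v` relative to the central hyperplane arrangement given by the linear forms
`φ i`: two points lie in the same face of the arrangement if and only if they have the same sign
vector. -/
def signVector (φ : ι → Dual 𝕜 V) (v : V) : ι → SignType := fun i => SignType.sign (φ i v)

theorem ncard_range_signVector_comp_equiv (e : κ ≃ ι) (φ : ι → Dual 𝕜 V) :
    (Set.range (signVector (φ ∘ e))).ncard = (Set.range (signVector φ)).ncard := by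
  have : signVector (φ ∘ e) = Equiv.arrowCongr e.symm (Equiv.refl _) ∘ signVector φ := rfl
  rw [this, Set.range_comp, Set.ncard_image_of_injective _ (Equiv.injective _)]

theorem ncard_range_signVector_option_of_eq_zero {φ : Option ι → Dual 𝕜 V}
    (h : φ none = 0) : (Set.range (signVector φ)).ncard =
      (Set.range (signVector fun i => φ (some i))).ncard := by
  have hcons : Equiv.piOptionEquivProd ∘ signVector φ =
      Prod.mk 0 ∘ signVector (fun i => φ (some i)) :=
    funext fun v => Prod.ext (by simp [Equiv.piOptionEquivProd, signVector, h]) rfl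
  rw [← Set.ncard_image_of_injective _ Equiv.piOptionEquivProd.injective, ← Set.range_comp, hcons,
    Set.range_comp, Set.ncard_image_of_injective _ (Prod.mk_right_injective 0)]

theorem sign_eq_of_mem_uIcc {a b r : 𝕜} (hr : r ∈ Set.uIcc a b)
    (hab : SignType.sign a = SignType.sign b) : SignType.sign r = SignType.sign a := by
  simpa [hab] using SignType.sign.monotone.mapsTo_uIcc hr

theorem zero_mem_uIcc_of_sign_ne {a b : 𝕜} (h : SignType.sign a ≠ SignType.sign b) :
    (0 : 𝕜) ∈ Set.uIcc a b := by
  contrapose! h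
  rw [Set.mem_uIcc] at h
  push Not at h
  rcases lt_trichotomy a 0 with ha | rfl | ha
  · rw [sign_neg ha, sign_neg (h.1 ha.le)]
  · exact absurd (h.2 (h.1 le_rfl).le) (lt_irrefl 0)
  · rw [sign_pos ha, sign_pos (not_le.1 fun hb => ha.not_gt (h.2 hb))]

variable [IsStrictOrderedRing 𝕜]

theorem exists_mem_ker_signVector_eq {φ : ι → Dual 𝕜 V} {ψ : Dual 𝕜 V} {v w : V}
    (hvw : signVector φ v = signVector φ w) (hne : SignType.sign (ψ v) ≠ SignType.sign (ψ w)) :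
    ∃ u ∈ LinearMap.ker ψ, signVector φ u = signVector φ w := by
  have hzero : (0 : 𝕜) ∈ ψ '' segment 𝕜 w v := by
    rw [← LinearMap.coe_toAffineMap, image_segment, segment_eq_uIcc]
    exact zero_mem_uIcc_of_sign_ne hne.symm
  obtain ⟨u, hu, hψu⟩ := hzero
  refine ⟨u, hψu, funext fun i => ?_⟩
  refine sign_eq_of_mem_uIcc (b := φ i v) ?_ (congrFun hvw i).symm
  rw [← segment_eq_uIcc]
  exact image_segment 𝕜 (φ i).toAffineMap w v ▸ Set.mem_image_of_mem _ hu

theorem ncard_range_signVector_option_le [Finite ι] (φ : Option ι → Dual 𝕜 V) :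
    (Set.range (signVector φ)).ncard ≤ (Set.range (signVector fun i => φ (some i))).ncard +
      3 * (Set.range (signVector fun i =>
        (φ (some i)).domRestrict (LinearMap.ker (φ none)))).ncard := by
  set R := Set.range (signVector fun i => φ (some i))
  set R₀ := Set.range (signVector fun i => (φ (some i)).domRestrict (LinearMap.ker (φ none)))
  let g : R → SignType × (ι → SignType) := fun σ =>
    (SignType.sign (φ none (Set.rangeSplitting _ σ)), σ)
  have hcover : Equiv.piOptionEquivProd '' Set.range (signVector φ) ⊆
      Set.range g ∪ Set.univ ×ˢ R₀ := by
    rintro _ ⟨_, ⟨w, rfl⟩, rfl⟩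
    set v := Set.rangeSplitting (signVector fun i => φ (some i)) ⟨_, w, rfl⟩
    have hv : signVector (fun i => φ (some i)) v = signVector (fun i => φ (some i)) w :=
      Set.apply_rangeSplitting (signVector fun i => φ (some i)) ⟨_, w, rfl⟩
    -- A face on which `φ none` changes sign meets its kernel, by convexity.
    by_cases hs : SignType.sign (φ none v) = SignType.sign (φ none w)
    · exact Or.inl ⟨⟨_, w, rfl⟩, Prod.ext hs rfl⟩
    · obtain ⟨u, hu, huw⟩ := exists_mem_ker_signVector_eq hv hs
      exact Or.inr ⟨trivial, ⟨u, hu⟩, huw⟩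
  have hR : (Set.range g).ncard ≤ R.ncard := by
    rw [← Set.image_univ, ← Nat.card_coe_set_eq R, ← Set.ncard_univ]
    exact Set.ncard_image_le
  calc (Set.range (signVector φ)).ncard
      = (Equiv.piOptionEquivProd '' Set.range (signVector φ)).ncard :=
        (Set.ncard_image_of_injective _ (Equiv.injective _)).symm
    _ ≤ (Set.range g).ncard + (Set.univ ×ˢ R₀).ncard :=
        (Set.ncard_le_ncard hcover).trans (Set.ncard_union_le _ _)
    _ ≤ R.ncard + 3 * R₀.ncard := by
        rw [Set.ncard_prod, Set.ncard_univ, Nat.card_eq_fintype_card]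
        exact Nat.add_le_add_right hR _

theorem ncard_range_signVector_le [Finite ι] [FiniteDimensional 𝕜 V] (φ : ι → Dual 𝕜 V) :
    (Set.range (signVector φ)).ncard ≤ (3 * Nat.card ι + 1) ^ finrank 𝕜 V := by
  induction ι using Finite.induction_empty_option generalizing V with
  | of_equiv e ih =>
    rw [← ncard_range_signVector_comp_equiv e, ← Nat.card_congr e]
    exact ih _
  | h_empty => simpa using Set.ncard_le_one_of_subsingleton (Set.range (signVector φ))
  | @h_option ι _ ih =>
    rw [Finite.card_option]
    set p := Nat.card ι
    by_cases hφ : φ none = 0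
    · rw [ncard_range_signVector_option_of_eq_zero hφ]
      exact (ih _).trans (Nat.pow_le_pow_left (by omega) _)
    · have hrank := Dual.finrank_ker_add_one_of_ne_zero hφ
      set r := finrank 𝕜 (LinearMap.ker (φ none))
      calc (Set.range (signVector φ)).ncard
          ≤ (3 * p + 1) ^ finrank 𝕜 V + 3 * (3 * p + 1) ^ r :=
            (ncard_range_signVector_option_le φ).trans
              (Nat.add_le_add (ih _) (Nat.mul_le_mul_left _ (ih _)))
        _ = (3 * p + 1) ^ r * (3 * (p + 1) + 1) := by rw [← hrank]; ring
        _ ≤ (3 * (p + 1) + 1) ^ r * (3 * (p + 1) + 1) := by gcongr; omega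
        _ = (3 * (p + 1) + 1) ^ finrank 𝕜 V := by rw [← hrank, pow_succ]

end SignVector

namespace WeightBalancedKMeans

variable {d k n : ℕ} {x : Fin n → EuclideanSpace ℝ (Fin d)} {ω : Fin n → ℝ}
  {κlo κhi : Fin k → ℝ} {s : Sites d k} {y z : Assignment k n} {μ : Fin k → ℝ}

/-- The cost of assigning a unit of weight of point `j` to cluster `i`, so that the objective is
the total cost of an assignment. -/
noncomputable def cost (x : Fin n → EuclideanSpace ℝ (Fin d)) (s : Sites d k)
    (i : Fin k) (j : Fin n) : ℝ :=
  inner ℝ (s i) (s i) - 2 * inner ℝ (x j) (s i)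

/-- `μ` are multipliers of the cluster size constraints that satisfy complementary slackness
together with `y`. Geometrically, `y` respects the power diagram with sites `s` and
weights `-μ`. -/
structure IsDualCertificate (x : Fin n → EuclideanSpace ℝ (Fin d)) (ω : Fin n → ℝ)
    (κlo κhi : Fin k → ℝ) (s : Sites d k) (y : Assignment k n) (μ : Fin k → ℝ) : Prop where
  cost_le : ∀ i j, y i j ≠ 0 → ∀ i', cost x s i j + μ i ≤ cost x s i' j + μ i'
  nonneg : ∀ i, κlo i < clusterSize ω y i → 0 ≤ μ i
  nonpos : ∀ i, clusterSize ω y i < κhi i → μ i ≤ 0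

section WeakDuality

theorem objective_add_sum_mul_clusterSize (x : Fin n → EuclideanSpace ℝ (Fin d)) (ω : Fin n → ℝ)
    (s : Sites d k) (y : Assignment k n) (μ : Fin k → ℝ) :
    objective x ω s y + ∑ i, μ i * clusterSize ω y i =
      ∑ j, ω j * ∑ i, y i j * (cost x s i j + μ i) := by
  simp only [objective, clusterSize, cost, Finset.mul_sum, ← Finset.sum_add_distrib]
  rw [Finset.sum_comm]
  exact Finset.sum_congr rfl fun j _ => Finset.sum_congr rfl fun i _ => by ring

theorem IsDualCertificate.sum_mul_cost_le (h : IsDualCertificate x ω κlo κhi s y μ)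
    (hy : y ∈ partitionPolytope ω κlo κhi) (hz : z ∈ partitionPolytope ω κlo κhi) (j : Fin n) :
    ∑ i, y i j * (cost x s i j + μ i) ≤ ∑ i, z i j * (cost x s i j + μ i) := by
  obtain ⟨-, hysum, hy0⟩ := hy
  obtain ⟨-, hzsum, hz0⟩ := hz
  obtain ⟨i₀, -, hi₀⟩ : ∃ i ∈ Finset.univ, y i j ≠ 0 :=
    Finset.exists_ne_zero_of_sum_ne_zero ((hysum j).trans_ne one_ne_zero)
  calc ∑ i, y i j * (cost x s i j + μ i) ≤ ∑ i, y i j * (cost x s i₀ j + μ i₀) := by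
        refine Finset.sum_le_sum fun i _ => ?_
        by_cases hi : y i j = 0
        · simp [hi]
        · exact mul_le_mul_of_nonneg_left (h.cost_le i j hi i₀) (hy0 i j)
    _ = ∑ i, z i j * (cost x s i₀ j + μ i₀) := by
        rw [← Finset.sum_mul, ← Finset.sum_mul, hysum, hzsum]
    _ ≤ ∑ i, z i j * (cost x s i j + μ i) := Finset.sum_le_sum fun i _ =>
        mul_le_mul_of_nonneg_left (h.cost_le i₀ j hi₀ i) (hz0 i j)

theorem IsDualCertificate.mul_clusterSize_le (h : IsDualCertificate x ω κlo κhi s y μ)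
    (hz : z ∈ partitionPolytope ω κlo κhi) (i : Fin k) :
    μ i * clusterSize ω z i ≤ μ i * clusterSize ω y i := by
  rcases lt_trichotomy (μ i) 0 with hμ | hμ | hμ
  · have hle : clusterSize ω y i ≤ κlo i := not_lt.1 (mt (h.nonneg i) hμ.not_ge)
    exact mul_le_mul_of_nonpos_left (hle.trans (hz.1 i).1) hμ.le
  · simp [hμ]
  · have hle : κhi i ≤ clusterSize ω y i := not_lt.1 (mt (h.nonpos i) hμ.not_ge)
    exact mul_le_mul_of_nonneg_left ((hz.1 i).2.trans hle) hμ.le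

theorem IsDualCertificate.isMinOn_objective (h : IsDualCertificate x ω κlo κhi s y μ)
    (hω : ∀ j, 0 ≤ ω j) (hy : y ∈ partitionPolytope ω κlo κhi) :
    IsMinOn (objective x ω s) (partitionPolytope ω κlo κhi) y := by
  intro z hz
  have hcost : objective x ω s y + ∑ i, μ i * clusterSize ω y i ≤
      objective x ω s z + ∑ i, μ i * clusterSize ω z i := by
    simp only [objective_add_sum_mul_clusterSize]
    exact Finset.sum_le_sum fun j _ =>
      mul_le_mul_of_nonneg_left (h.sum_mul_cost_le hy hz j) (hω j)
  have hsize : ∑ i, μ i * clusterSize ω z i ≤ ∑ i, μ i * clusterSize ω y i :=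
    Finset.sum_le_sum fun i _ => h.mul_clusterSize_le hz i
  change objective x ω s y ≤ objective x ω s z
  linarith

end WeakDuality

section StrongDuality

open Module

/-- The objective for fixed sites, as a linear form. -/
noncomputable def objectiveForm (x : Fin n → EuclideanSpace ℝ (Fin d)) (ω : Fin n → ℝ)
    (s : Sites d k) : Dual ℝ (Assignment k n) where
  toFun := objective x ω s
  map_add' y z := by simp [objective, add_mul, Finset.sum_add_distrib]
  map_smul' r y := by simp [objective, Finset.mul_sum, mul_assoc]

@[simp]
theorem objectiveForm_apply (x : Fin n → EuclideanSpace ℝ (Fin d)) (ω : Fin n → ℝ)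
    (s : Sites d k) (y : Assignment k n) : objectiveForm x ω s y = objective x ω s y :=
  rfl

/-- The size of the `i`-th cluster, as a linear form. -/
def sizeForm (ω : Fin n → ℝ) (i : Fin k) : Dual ℝ (Assignment k n) where
  toFun y := clusterSize ω y i
  map_add' y z := by simp [clusterSize, add_mul, Finset.sum_add_distrib]
  map_smul' r y := by simp [clusterSize, Finset.mul_sum, mul_assoc]

@[simp]
theorem sizeForm_apply (ω : Fin n → ℝ) (i : Fin k) (y : Assignment k n) :
    sizeForm ω i y = clusterSize ω y i :=
  rfl

/-- The directions that keep every point fully assigned. -/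
def exchangeSpace (k n : ℕ) : Submodule ℝ (Assignment k n) where
  carrier := {v | ∀ j, ∑ i, v i j = 0}
  add_mem' hv hw j := by simp [Finset.sum_add_distrib, hv j, hw j]
  zero_mem' j := by simp
  smul_mem' r v hv j := by simp [← Finset.mul_sum, hv j]

theorem objective_nonneg_of_mem_exchangeSpace (hy : y ∈ partitionPolytope ω κlo κhi)
    (hmin : IsMinOn (objective x ω s) (partitionPolytope ω κlo κhi) y) {v : Assignment k n}
    (hv : v ∈ exchangeSpace k n) (hentry : ∀ i j, 0 ≤ y i j + v i j)
    (hlo : ∀ i, 0 ≤ clusterSize ω y i - κlo i + clusterSize ω v i)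
    (hhi : ∀ i, 0 ≤ κhi i - clusterSize ω y i + -clusterSize ω v i) :
    0 ≤ objective x ω s v := by
  have hsize (i) : clusterSize ω (y + v) i = clusterSize ω y i + clusterSize ω v i :=
    map_add (sizeForm ω i) y v
  have hmem : y + v ∈ partitionPolytope ω κlo κhi := by
    refine ⟨fun i => ⟨?_, ?_⟩, fun j => ?_, hentry⟩
    · linarith [hsize i, hlo i]
    · linarith [hsize i, hhi i]
    · simpa [Finset.sum_add_distrib, hy.2.1 j] using hv j
  have hle : objective x ω s y ≤ objective x ω s (y + v) := hmin hmem
  exact nonneg_of_le_add_right (hle.trans_eq (map_add (objectiveForm x ω s) y v))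

theorem exists_multipliers (hy : y ∈ partitionPolytope ω κlo κhi)
    (hmin : IsMinOn (objective x ω s) (partitionPolytope ω κlo κhi) y) :
    ∃ (β : Assignment k n) (lo hi : Fin k → ℝ),
      (∀ i j, 0 ≤ β i j ∧ (y i j ≠ 0 → β i j = 0)) ∧
      (∀ i, 0 ≤ lo i ∧ (κlo i < clusterSize ω y i → lo i = 0)) ∧
      (∀ i, 0 ≤ hi i ∧ (clusterSize ω y i < κhi i → hi i = 0)) ∧
      ∀ v ∈ exchangeSpace k n, objective x ω s v =
        ∑ i, ∑ j, β i j * v i j + ∑ i, (lo i - hi i) * clusterSize ω v i := by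
  let E := exchangeSpace k n
  let entry (q : Fin k × Fin n) : Dual ℝ (Assignment k n) :=
    LinearMap.proj q.2 ∘ₗ LinearMap.proj q.1
  let a : (Fin k × Fin n) ⊕ Fin k ⊕ Fin k → Dual ℝ E := fun q =>
    (Sum.elim entry (Sum.elim (sizeForm ω) (-sizeForm ω)) q).domRestrict E
  let slack : (Fin k × Fin n) ⊕ Fin k ⊕ Fin k → ℝ :=
    Sum.elim (fun q => y q.1 q.2)
      (Sum.elim (fun i => clusterSize ω y i - κlo i) fun i => κhi i - clusterSize ω y i)
  have hslack : ∀ q, 0 ≤ slack q := by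
    rintro (⟨i, j⟩ | i | i)
    · exact hy.2.2 i j
    · exact sub_nonneg.2 (hy.1 i).1
    · exact sub_nonneg.2 (hy.1 i).2
  have hfeasible : ∀ v : E, (∀ q, 0 ≤ slack q + a q v) →
      0 ≤ (objectiveForm x ω s).domRestrict E v := fun v hv =>
    objective_nonneg_of_mem_exchangeSpace hy hmin v.2 (fun i j => hv (.inl (i, j)))
      (fun i => hv (.inr (.inl i))) fun i => hv (.inr (.inr i))
  obtain ⟨b, hb, hbslack, hbsum⟩ := exists_complementary_multipliers a _ hslack hfeasible
  refine ⟨fun i j => b (.inl (i, j)), fun i => b (.inr (.inl i)), fun i => b (.inr (.inr i)),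
    fun i j => ⟨hb _, hbslack (.inl (i, j))⟩,
    fun i => ⟨hb _, fun h => hbslack (.inr (.inl i)) (sub_pos.2 h).ne'⟩,
    fun i => ⟨hb _, fun h => hbslack (.inr (.inr i)) (sub_pos.2 h).ne'⟩, fun v hv => ?_⟩
  have hobj := LinearMap.congr_fun hbsum ⟨v, hv⟩
  simpa [a, entry, Fintype.sum_prod_type, add_mul, Finset.sum_add_distrib, sub_eq_add_neg]
    using hobj

theorem eq_of_forall_sum_mul_eq_zero {R ι : Type*} [Ring R] [Fintype ι] {f : ι → R}
    (h : ∀ w : ι → R, ∑ i, w i = 0 → ∑ i, w i * f i = 0) (i i' : ι) : f i = f i' := by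
  classical
  have := h (Pi.single i 1 - Pi.single i' 1) (by simp)
  simpa [sub_mul, Pi.single_apply, sub_eq_zero] using this

theorem exists_isDualCertificate (hω : ∀ j, 0 < ω j) (hy : y ∈ partitionPolytope ω κlo κhi)
    (hmin : IsMinOn (objective x ω s) (partitionPolytope ω κlo κhi) y) :
    ∃ μ, IsDualCertificate x ω κlo κhi s y μ := by
  obtain ⟨β, lo, hi, hβ, hlo, hhi, hobj⟩ := exists_multipliers hy hmin
  have hconst (j : Fin n) : ∀ i i', ω j * cost x s i j - β i j - (lo i - hi i) * ω j =
      ω j * cost x s i' j - β i' j - (lo i' - hi i') * ω j := by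
    refine eq_of_forall_sum_mul_eq_zero fun w hw => ?_
    have hexchange := hobj (fun i => Pi.single j (w i)) fun j' => by
      by_cases hj : j' = j <;> simp [hj, hw]
    simp only [objective, clusterSize, Pi.single_apply, ite_mul, zero_mul, mul_ite, mul_zero,
      Finset.sum_ite_eq', Finset.mem_univ, if_true] at hexchange
    rw [← sub_eq_zero, ← Finset.sum_add_distrib, ← Finset.sum_sub_distrib] at hexchange
    rw [← hexchange]
    exact Finset.sum_congr rfl fun i _ => by rw [cost]; ring
  refine ⟨fun i => hi i - lo i, fun i j hij i' => ?_, fun i hlt => ?_, fun i hlt => ?_⟩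
  · refine le_of_mul_le_mul_left ?_ (hω j)
    linarith [hconst j i i', (hβ i j).2 hij, (hβ i' j).1]
  · simpa [(hlo i).2 hlt] using (hhi i).1
  · simpa [(hhi i).2 hlt] using (hlo i).1

end StrongDuality

section SignPattern

open Module

/-- The data that decides which assignments the multipliers `μ` certify to be optimal: how the
shifted costs compare at every point, and which of the multipliers are positive, zero or
negative. -/
noncomputable def signPattern (x : Fin n → EuclideanSpace ℝ (Fin d)) (s : Sites d k)
    (μ : Fin k → ℝ) : (Fin n × Fin k × Fin k → SignType) × (Fin k → SignType) :=
  (fun q => SignType.sign ((cost x s q.2.1 q.1 + μ q.2.1) - (cost x s q.2.2 q.1 + μ q.2.2)),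
    fun i => SignType.sign (μ i))

theorem IsDualCertificate.of_signPattern_eq {s' : Sites d k} {μ' : Fin k → ℝ}
    (h : IsDualCertificate x ω κlo κhi s y μ) (heq : signPattern x s μ = signPattern x s' μ') :
    IsDualCertificate x ω κlo κhi s' y μ' := by
  have hcost (i i' j) : SignType.sign ((cost x s i j + μ i) - (cost x s i' j + μ i')) =
      SignType.sign ((cost x s' i j + μ' i) - (cost x s' i' j + μ' i')) :=
    congrFun (congrArg Prod.fst heq) (j, i, i')
  have hμ (i) : SignType.sign (μ i) = SignType.sign (μ' i) := congrFun (congrArg Prod.snd heq) i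
  refine ⟨fun i j hij i' => ?_, fun i hi => ?_, fun i hi => ?_⟩
  · rw [← sub_nonpos, ← sign_nonpos_iff, ← hcost, sign_nonpos_iff, sub_nonpos]
    exact h.cost_le i j hij i'
  · rw [← sign_nonneg_iff, ← hμ, sign_nonneg_iff]
    exact h.nonneg i hi
  · rw [← sign_nonpos_iff, ← hμ, sign_nonpos_iff]
    exact h.nonpos i hi

/-- Lifted sites: `(s, γ)` stands for the `k` affine functions `p ↦ γ i - 2 * ⟪p, s i⟫`. -/
abbrev LiftedSites (d k : ℕ) := Sites d k × (Fin k → ℝ)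

/-- The value of the `i`-th affine function at the point `p`, as a linear form in the lifted
sites. -/
noncomputable def evalForm (p : EuclideanSpace ℝ (Fin d)) (i : Fin k) :
    Dual ℝ (LiftedSites d k) where
  toFun P := P.2 i - 2 * inner ℝ p (P.1 i)
  map_add' P Q := by simp only [Prod.fst_add, Prod.snd_add, Pi.add_apply, inner_add_right]; ring
  map_smul' r P := by simp [inner_smul_right, mul_sub, mul_left_comm]

theorem finrank_ker_evalForm (p : EuclideanSpace ℝ (Fin d)) (i : Fin k) :
    finrank ℝ (LinearMap.ker (evalForm p i)) = (d + 1) * k - 1 := by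
  have hne : evalForm p i ≠ 0 := fun h => by
    simpa [evalForm] using LinearMap.congr_fun h ((0, 1) : LiftedSites d k)
  have hrank : finrank ℝ (LiftedSites d k) = (d + 1) * k := by
    rw [finrank_prod, finrank_pi_fintype, Finset.sum_const, finrank_euclideanSpace_fin,
      finrank_fin_fun, Finset.card_univ, Fintype.card_fin, smul_eq_mul]
    ring
  have := Dual.finrank_ker_add_one_of_ne_zero hne
  omega

/-- The difference of the affine functions of two clusters at one of the points `x`. -/
noncomputable def comparisonForm (x : Fin n → EuclideanSpace ℝ (Fin d))
    (q : Fin n × Fin k × Fin k) : Dual ℝ (LiftedSites d k) :=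
  evalForm (x q.1) q.2.1 - evalForm (x q.1) q.2.2

/-- The lifted sites with affine functions `p ↦ ‖s i‖ ^ 2 - 2 * ⟪p, s i⟫ + μ i`, up to a common
shift by which the `i₀`-th of them vanishes at the origin. -/
noncomputable def liftSites (i₀ : Fin k) (s : Sites d k) (μ : Fin k → ℝ) : LiftedSites d k :=
  (s, fun i => (inner ℝ (s i) (s i) + μ i) - (inner ℝ (s i₀) (s i₀) + μ i₀))

theorem liftSites_mem_ker (i₀ : Fin k) (s : Sites d k) (μ : Fin k → ℝ) :
    liftSites i₀ s μ ∈ LinearMap.ker (evalForm 0 i₀) := by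
  simp [liftSites, evalForm]

theorem comparisonForm_liftSites (x : Fin n → EuclideanSpace ℝ (Fin d)) (i₀ : Fin k)
    (s : Sites d k) (μ : Fin k → ℝ) (q : Fin n × Fin k × Fin k) :
    comparisonForm x q (liftSites i₀ s μ) =
      (cost x s q.2.1 q.1 + μ q.2.1) - (cost x s q.2.2 q.1 + μ q.2.2) := by
  simp only [comparisonForm, evalForm, liftSites, cost, LinearMap.sub_apply, LinearMap.coe_mk,
    AddHom.coe_mk]
  ring

theorem ncard_range_signPattern_le (x : Fin n → EuclideanSpace ℝ (Fin d)) (i₀ : Fin k) :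
    (Set.range fun P : Sites d k × (Fin k → ℝ) => signPattern x P.1 P.2).ncard ≤
      (3 * (n * (k * k)) + 1) ^ ((d + 1) * k - 1) * 3 ^ k := by
  -- Only differences of the affine functions matter, so one degree of freedom can be removed.
  let K := LinearMap.ker (evalForm (0 : EuclideanSpace ℝ (Fin d)) i₀)
  let φ : Fin n × Fin k × Fin k → Dual ℝ K := fun q => (comparisonForm x q).domRestrict K
  have hsub : (Set.range fun P : Sites d k × (Fin k → ℝ) => signPattern x P.1 P.2) ⊆
      Set.range (signVector φ) ×ˢ Set.univ := by
    rintro _ ⟨⟨s, μ⟩, rfl⟩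
    refine ⟨⟨⟨_, liftSites_mem_ker i₀ s μ⟩, funext fun q => ?_⟩, trivial⟩
    exact congrArg SignType.sign (comparisonForm_liftSites x i₀ s μ q)
  calc _ ≤ (Set.range (signVector φ) ×ˢ (Set.univ : Set (Fin k → SignType))).ncard :=
        Set.ncard_le_ncard hsub
    _ = (Set.range (signVector φ)).ncard * 3 ^ k := by
        rw [Set.ncard_prod, Set.ncard_univ, Nat.card_fun, Nat.card_fin,
          Nat.card_eq_fintype_card (α := SignType)]
        rfl
    _ ≤ _ := by
        gcongr
        simpa [K, finrank_ker_evalForm] using ncard_range_signVector_le φ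

end SignPattern

section Descent

theorem clusterSize_smul_centerOfGravity {i : Fin k} (hy : clusterSize ω y i ≠ 0) :
    clusterSize ω y i • centerOfGravity x ω y i = ∑ j, (y i j * ω j) • x j :=
  smul_inv_smul₀ hy _

theorem objective_eq_sum_mul_sub (hy : ∀ i, clusterSize ω y i ≠ 0) (s : Sites d k) :
    objective x ω s y = ∑ i, clusterSize ω y i *
      (‖s i - centerOfGravity x ω y i‖ ^ 2 - ‖centerOfGravity x ω y i‖ ^ 2) := by
  refine Finset.sum_congr rfl fun i _ => ?_
  have hinner : clusterSize ω y i * inner ℝ (s i) (centerOfGravity x ω y i) =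
      ∑ j, y i j * ω j * inner ℝ (x j) (s i) := by
    rw [← real_inner_smul_right, clusterSize_smul_centerOfGravity (hy i), inner_sum]
    simp only [real_inner_smul_right, real_inner_comm]
  calc ∑ j, y i j * ω j * (inner ℝ (s i) (s i) - 2 * inner ℝ (x j) (s i))
      = clusterSize ω y i * ‖s i‖ ^ 2 -
          2 * (clusterSize ω y i * inner ℝ (s i) (centerOfGravity x ω y i)) := by
        rw [hinner, clusterSize, Finset.sum_mul, Finset.mul_sum, ← Finset.sum_sub_distrib]
        exact Finset.sum_congr rfl fun j _ => by rw [real_inner_self_eq_norm_sq]; ring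
    _ = _ := by rw [norm_sub_sq_real]; ring

theorem objective_centerOfGravity_le (hy : ∀ i, 0 < clusterSize ω y i) (s : Sites d k) :
    objective x ω (centerOfGravity x ω y) y ≤ objective x ω s y := by
  simp only [objective_eq_sum_mul_sub fun i => (hy i).ne']
  refine Finset.sum_le_sum fun i _ => mul_le_mul_of_nonneg_left ?_ (hy i).le
  simp

end Descent

section Execution

/-- A run of `N` iterations of weight-balanced `k`-means in which the assignment step may return
any optimal solution of the linear program, not necessarily a vertex. The indexing is that of
`IsExecution`. -/
structure IsRelaxedExecution (x : Fin n → EuclideanSpace ℝ (Fin d)) (ω : Fin n → ℝ)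
    (κlo κhi : Fin k → ℝ) (N : ℕ) (s : ℕ → Sites d k) (y : ℕ → Assignment k n) : Prop where
  mem : ∀ l < N, y l ∈ partitionPolytope ω κlo κhi
  isMinOn : ∀ l < N, IsMinOn (objective x ω (s l)) (partitionPolytope ω κlo κhi) (y l)
  update : ∀ l < N, ∀ i, s (l + 1) i = centerOfGravity x ω (y l) i
  decrease : ∀ l, l + 2 < N → objective x ω (s (l + 1)) (y (l + 1)) < objective x ω (s l) (y l)

variable {N : ℕ} {s : ℕ → Sites d k} {y : ℕ → Assignment k n}

theorem IsExecution.isRelaxedExecution {s₀ : Sites d k}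
    (h : IsExecution x ω κlo κhi s₀ N s y) : IsRelaxedExecution x ω κlo κhi N s y :=
  ⟨fun l hl => (h.assign l hl).1.1, fun l hl => (h.assign l hl).2, h.update, h.decrease⟩

namespace IsRelaxedExecution

theorem clusterSize_pos (h : IsRelaxedExecution x ω κlo κhi N s y) (hκlo : ∀ i, 0 < κlo i)
    {l : ℕ} (hl : l < N) (i : Fin k) : 0 < clusterSize ω (y l) i :=
  (hκlo i).trans_le ((h.mem l hl).1 i).1

theorem strictAntiOn_objective (h : IsRelaxedExecution x ω κlo κhi N s y) :
    StrictAntiOn (fun l => objective x ω (s l) (y l)) (Set.Iio (N - 1)) :=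
  strictAntiOn_of_add_one_lt Set.ordConnected_Iio fun l _ _ hl =>
    h.decrease l (by have := Set.mem_Iio.1 hl; omega)

theorem objective_lt_of_add_one_lt (h : IsRelaxedExecution x ω κlo κhi N s y)
    (hκlo : ∀ i, 0 < κlo i) {l m : ℕ} (hlm : l + 1 < m) (hm : m + 1 < N) :
    objective x ω (s m) (y m) < objective x ω (s m) (y l) := by
  have hl : l < N := by omega
  have hs : s (l + 1) = centerOfGravity x ω (y l) := funext (h.update l hl)
  calc objective x ω (s m) (y m) < objective x ω (s (l + 1)) (y (l + 1)) :=
        h.strictAntiOn_objective (Set.mem_Iio.2 (by omega)) (Set.mem_Iio.2 (by omega)) hlm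
    _ ≤ objective x ω (s (l + 1)) (y l) := h.isMinOn (l + 1) (by omega) (h.mem l hl)
    _ ≤ objective x ω (s m) (y l) := by
        rw [hs]
        exact objective_centerOfGravity_le (h.clusterSize_pos hκlo hl) _

theorem signPattern_ne (h : IsRelaxedExecution x ω κlo κhi N s y) (hω : ∀ j, 0 ≤ ω j)
    (hκlo : ∀ i, 0 < κlo i) {l m : ℕ} (hlm : l + 1 < m) (hm : m + 1 < N) {μ ν : Fin k → ℝ}
    (hμ : IsDualCertificate x ω κlo κhi (s l) (y l) μ) :
    signPattern x (s l) μ ≠ signPattern x (s m) ν := fun heq =>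
  (h.objective_lt_of_add_one_lt hκlo hlm hm).not_ge <|
    (hμ.of_signPattern_eq heq).isMinOn_objective hω (h.mem l (by omega)) (h.mem m (by omega))

theorem half_le (h : IsRelaxedExecution x ω κlo κhi N s y) (hω : ∀ j, 0 < ω j)
    (hκlo : ∀ i, 0 < κlo i) (i₀ : Fin k) :
    N / 2 ≤ (3 * (n * (k * k)) + 1) ^ ((d + 1) * k - 1) * 3 ^ k := by
  have hdual : ∀ l < N, ∃ μ, IsDualCertificate x ω κlo κhi (s l) (y l) μ := fun l hl =>
    exists_isDualCertificate hω (h.mem l hl) (h.isMinOn l hl)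
  choose! μ hμ using hdual
  let pattern : Fin (N / 2) → (Fin n × Fin k × Fin k → SignType) × (Fin k → SignType) :=
    fun l => signPattern x (s (2 * l)) (μ (2 * l))
  have hinj : Function.Injective pattern := .of_lt_imp_ne fun l m hlm =>
    h.signPattern_ne (fun j => (hω j).le) hκlo (by omega) (by omega) (hμ _ (by omega))
  calc N / 2 = (Set.range pattern).ncard := by
        rw [← Nat.card_coe_set_eq, Nat.card_range_of_injective hinj, Nat.card_fin]
    _ ≤ (Set.range fun P : Sites d k × (Fin k → ℝ) => signPattern x P.1 P.2).ncard :=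
        Set.ncard_le_ncard (Set.range_subset_iff.2 fun l => ⟨(_, _), rfl⟩)
    _ ≤ _ := ncard_range_signPattern_le x i₀

end IsRelaxedExecution

end Execution

theorem le_pow_of_half_le_mul_pow {N A k M : ℕ} (hk : 2 ≤ k) (hM : k - 1 ≤ M) (hA : 0 < A)
    (hN : N / 2 ≤ (3 * A + 1) ^ M * 3 ^ k) : N ≤ (108 * A) ^ M := by
  have hpos : 0 < (3 * A + 1) ^ M * 3 ^ k := by positivity
  calc N ≤ 3 * ((3 * A + 1) ^ M * 3 ^ k) := by omega
    _ = (3 * A + 1) ^ M * 3 ^ (k + 1) := by ring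
    _ ≤ (4 * A) ^ M * 3 ^ (3 * M) := by
        gcongr
        · omega
        · norm_num
        · omega
    _ = (108 * A) ^ M := by rw [pow_mul, ← mul_pow]; ring

end WeightBalancedKMeans

theorem theorem5p3_general (d k n : ℕ) (hk : 2 ≤ k) (x : Fin n → EuclideanSpace ℝ (Fin d))
    (ω : Fin n → ℝ) (hω : ∀ j, 0 < ω j) (κlo κhi : Fin k → ℝ) (hκlo : ∀ i, 0 < κlo i) (N : ℕ)
    (s : ℕ → WeightBalancedKMeans.Sites d k) (y : ℕ → WeightBalancedKMeans.Assignment k n)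
    (hrun : WeightBalancedKMeans.IsRelaxedExecution x ω κlo κhi N s y) :
    (N : ℝ) ≤ (40 * Real.exp 1 * (k : ℝ) ^ 2 * (n : ℝ)) ^ ((d + 1) * k - 1) := by
  rcases N.eq_zero_or_pos with rfl | hN
  · simp only [Nat.cast_zero]
    positivity
  let i₀ : Fin k := ⟨0, by omega⟩
  have hn : 0 < n := by
    rcases n.eq_zero_or_pos with rfl | hn
    · simpa [WeightBalancedKMeans.clusterSize] using hrun.clusterSize_pos hκlo hN i₀
    · exact hn
  have hexp : k - 1 ≤ (d + 1) * k - 1 :=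
    Nat.sub_le_sub_right (Nat.le_mul_of_pos_left k d.succ_pos) 1
  have hnat : N ≤ (108 * (n * (k * k))) ^ ((d + 1) * k - 1) :=
    WeightBalancedKMeans.le_pow_of_half_le_mul_pow hk hexp (by positivity) (hrun.half_le hω hκlo i₀)
  calc (N : ℝ) ≤ (108 * (n * (k * k))) ^ ((d + 1) * k - 1) := by exact_mod_cast hnat
    _ = (108 * (k : ℝ) ^ 2 * n) ^ ((d + 1) * k - 1) := by ring
    _ ≤ _ := by
      gcongr
      linarith [Real.exp_one_gt_d9]

theorem theorem5p3 (d k n : ℕ) (hk : 2 ≤ k) (hkn : k ≤ n)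
    (x : Fin n → EuclideanSpace ℝ (Fin d)) (hx : Function.Injective x)
    (ω : Fin n → ℝ) (hω : ∀ j, 0 < ω j)
    (κlo κhi : Fin k → ℝ) (hκlo : ∀ i, 0 < κlo i) (hκ : ∀ i, κlo i ≤ κhi i)
    (hlo : ∑ i, κlo i ≤ ∑ j, ω j) (hhi : ∑ j, ω j ≤ ∑ i, κhi i)
    (s₀ : WeightBalancedKMeans.Sites d k) (N : ℕ)
    (s : ℕ → WeightBalancedKMeans.Sites d k) (y : ℕ → WeightBalancedKMeans.Assignment k n)
    (hrun : WeightBalancedKMeans.IsExecution x ω κlo κhi s₀ N s y) :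
    (N : ℝ) ≤ (40 * Real.exp 1 * (k : ℝ) ^ 2 * (n : ℝ)) ^ ((d + 1) * k - 1) :=
  theorem5p3_general d k n hk x ω hω κlo κhi hκlo N s y hrun.isRelaxedExecution
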